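/- Let $k$ be a finite field with $q$ elements and characteristic $p$. Let $k_1\langle X\rangle$ be the free unitary associative $k$-algebra on a countably infinite set $X$ of variables, and let $x_1,x_2,x_3\in X$ be distinct. Write $[a,b]=ab-ba$ and $[a,b,c]=[[a,b],c]$. A $T$-ideal of $k_1\langle X\rangle$ is a two-sided ideal that is mapped into itself by every unitary $k$-algebra endomorphism of $k_1\langle X\rangle$, and for $B\subseteq k_1\langle X\rangle$ let $B^T$ denote the smallest $T$-ideal that contains $B$. Let $G$ be the infinite dimensional unitary Grassmann algebra over $k$, that is, the exterior algebra of a $k$-vector space with basis $e_1,e_2,\dots$ (so $e_ie_j=-e_je_i$ and $e_i^2=0$ for all $i,j$, and the products $e_{i_1}\cdots e_{i_n}$ with $n\ge 0$ and $i_1<\cdots<i_n$ form a $k$-basis of $G$). Let $T(G)$ be the set of all $f\in k_1\langle X\rangle$ with $\varphi(f)=0$ for every unitary $k$-algebra homomorphism $\varphi\colon k_1\langle X\rangle\to G$. Then $$T(G)=\{\,x_1^2-x_1^{2q},\ [x_1,x_2]\,\}^T\quad\text{if } p=2,$$ $$T(G)=\{\,x_1^{qp}-x_1^p,\ [x_1,x_2,x_3]\,\}^T\quad\text{if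 } p>2.$$ -/

import Mathlib

/-- A two-sided ideal of a unitary `k`-algebra is a T-ideal if it is mapped into itself by every
(unitary) `k`-algebra endomorphism. (A two-sided ideal of a unitary `k`-algebra is automatically
a `k`-linear subspace.) -/
def IsTIdeal (k : Type*) {A : Type*} [CommRing k] [Ring A] [Algebra k A]
    (I : TwoSidedIdeal A) : Prop :=
  ∀ φ : A →ₐ[k] A, ∀ a ∈ I, φ a ∈ I

/-- The T-ideal generated by a set `B`: the intersection of all T-ideals that contain `B`. -/
def tIdealSpan (k : Type*) {A : Type*} [CommRing k] [Ring A] [Algebra k A]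
    (B : Set A) : TwoSidedIdeal A :=
  sInf {I : TwoSidedIdeal A | IsTIdeal k I ∧ B ⊆ (I : Set A)}

/-- The generated T-ideal is indeed the smallest T-ideal that contains `B`. -/
theorem isLeast_tIdealSpan (k : Type*) {A : Type*} [CommRing k] [Ring A] [Algebra k A]
    (B : Set A) :
    IsLeast {I : TwoSidedIdeal A | IsTIdeal k I ∧ B ⊆ (I : Set A)} (tIdealSpan k B) := by
  refine ⟨⟨fun φ a ha => ?_, fun b hb => ?_⟩, fun I hI => sInf_le hI⟩
  · rw [tIdealSpan, TwoSidedIdeal.mem_sInf] at ha ⊢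
    exact fun I hI => hI.1 φ a (ha I hI)
  · change b ∈ tIdealSpan k B
    rw [tIdealSpan, TwoSidedIdeal.mem_sInf]
    exact fun I hI => hI.2 hb

/-- `T(A)`: the identities (together with `0`) of the unitary `k`-algebra `A`, that is, the
elements of the free unitary associative algebra on countably many variables that are killed by
every unitary `k`-algebra homomorphism to `A`. -/
def identitiesTIdeal (k A : Type*) [CommRing k] [Ring A] [Algebra k A] :
    TwoSidedIdeal (FreeAlgebra k ℕ) :=
  TwoSidedIdeal.mk' {f | ∀ φ : FreeAlgebra k ℕ →ₐ[k] A, φ f = 0}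
    (fun φ => map_zero φ)
    (fun hx hy φ => by rw [map_add, hx φ, hy φ, add_zero])
    (fun hx φ => by rw [map_neg, hx φ, neg_zero])
    (fun hy φ => by rw [map_mul, hy φ, mul_zero])
    (fun hx φ => by rw [map_mul, hx φ, zero_mul])

theorem mem_identitiesTIdeal {k A : Type*} [CommRing k] [Ring A] [Algebra k A]
    {f : FreeAlgebra k ℕ} :
    f ∈ identitiesTIdeal k A ↔ ∀ φ : FreeAlgebra k ℕ →ₐ[k] A, φ f = 0 := by
  rw [identitiesTIdeal, TwoSidedIdeal.mem_mk']
  rfl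

/-- The infinite dimensional unitary Grassmann algebra over `k`: the exterior algebra of a vector
space with a countably infinite basis. -/
abbrev InfGrassmann (k : Type*) [CommRing k] : Type _ :=
  ExteriorAlgebra k (ℕ →₀ k)

/-!
The ideal generated by the given identities consists of identities of the Grassmann algebra `G`:
even elements of `G` are central and odd elements anticommute, so commutators are central (and
vanish in characteristic two), and `g ^ p` is the `p`-th power of the scalar part of `g`, a scalar
on which the `|k|`-th power map is the identity.

For the converse, let `A` be the quotient of the free algebra by the T-ideal in question.

If `p = 2`, then `A` is commutative, so that every element is a polynomial in the variables, and
`a ^ (2 * |k|) = a ^ 2` allows all exponents to be taken less than `2 * |k|`. A polynomial `f` that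
is reduced in this sense is determined by its values at the points `a + n`, with `a` running over
the `k`-rational points and `n i` over independent elements of square zero: these values encode the
Taylor coefficients of order less than two in each variable, at all rational points
(`MvPolynomial.eq_zero_of_aeval_add_nilpotent`, which holds for any nilpotency order). Such `n i`
exist in `G`.

If `p > 2`, then commutators of `A` are central, and this makes the symmetrized product
`(a * b + b * a) / 2` of `A` associative (`SymAlg.instCommRing`). So `A` is a commutative algebra
for this product, it carries the biderivation `⁅a, b⁆`, and
`a * b` is the sum of the symmetrized product and `⁅a, b⁆ / 2`. Hence `A` is spanned by products of
a polynomial in the variables `x i` and a product of commutators `⁅x i, x j⁆`. Products of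
commutators are alternating in all the variables involved (`lie_mul_lie_add`), so there is, up to
sign, only one for each finite set `J` of even size. As `a ^ (|k| * p) = a ^ p`, the polynomials may
be taken reduced (`exists_normalForm`).

Finally, if a sum `∑ J, f J * c J` of this form vanishes under all substitutions from `G`, then
`f J = 0` for every `J` (`normalForm_eq_zero`). Indeed, for `J` minimal with `f J ≠ 0` substitute
`a i + n i + ε i` for `x i`, where `a i` is a scalar, `n i` is a sum of `p - 1` products of two
generators, and `ε i` is a generator for `i ∈ J` and zero otherwise. Then `c K` vanishes for
`K ⊄ J`, and `c J` is a multiple of the product of the `ε i` with `i ∈ J`, so that it is killed by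
each of these. What remains is `f J (a + n) * c J = 0`, and `f J = 0` follows as before, because
`n i` is nilpotent of exact order `p`.
-/

/-! ### Reduced polynomials and nilpotent points -/

section PolynomialSeparation

open Polynomial in
theorem Polynomial.eq_zero_of_coeff_comp_X_add_C {k : Type*} [Field k] [Finite k] {m : ℕ}
    {P : k[X]} (hdeg : P.degree < ((Nat.card k * m : ℕ) : WithBot ℕ))
    (h : ∀ a : k, ∀ j < m, (P.comp (X + C a)).coeff j = 0) : P = 0 := by
  have := Fintype.ofFinite k
  have hdvd : (∏ a : k, (X - C a) ^ m) ∣ P := by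
    refine Finset.prod_dvd_of_coprime (fun a _ b _ hab => ?_) fun a _ => ?_
    · exact (Polynomial.pairwise_coprime_X_sub_C Function.injective_id hab).pow
    · rw [Polynomial.X_sub_C_pow_dvd_iff, Polynomial.X_pow_dvd_iff]
      exact h a
  refine Polynomial.eq_zero_of_dvd_of_degree_lt hdvd ?_
  rw [Finset.prod_pow, Polynomial.degree_pow, Polynomial.degree_prod]
  simpa [Nat.card_eq_fintype_card, mul_comm] using hdeg

open Polynomial in
/-- The functionals "`j`-th Taylor coefficient at `a`", for `a ∈ k` and `j < m`, separate
polynomials of degree less than `|k| * m`; hence the coefficient functionals on this space are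
linear combinations of them. -/
theorem exists_coeff_eq_sum_taylor (k : Type*) [Field k] [Fintype k] (m : ℕ) :
    ∃ L : ℕ → k × Fin m → k, ∀ b < Fintype.card k * m, ∀ b' < Fintype.card k * m,
      ∑ γ, L b γ * (((X + C γ.1) ^ b' : k[X]).coeff γ.2) = if b = b' then 1 else 0 := by
  classical
  set N := Fintype.card k * m
  let T : (Fin N → k) →ₗ[k] (k × Fin m → k) :=
    Matrix.mulVecLin (Matrix.of fun γ b => ((X + C γ.1) ^ (b : ℕ) : k[X]).coeff γ.2)
  have hT : LinearMap.ker T = ⊥ := by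
    rw [LinearMap.ker_eq_bot']
    intro v hv
    have hP : ∑ b : Fin N, C (v b) * X ^ (b : ℕ) = 0 := by
      refine Polynomial.eq_zero_of_coeff_comp_X_add_C (m := m) ?_ fun a j hj => ?_
      · rw [Nat.card_eq_fintype_card]
        refine (Polynomial.degree_sum_le _ _).trans_lt ?_
        refine (Finset.sup_lt_iff (WithBot.bot_lt_coe _)).2 fun b _ => ?_
        exact (Polynomial.degree_C_mul_X_pow_le _ _).trans_lt (by exact_mod_cast b.2)
      · have := congrFun hv (a, ⟨j, hj⟩)
        simp only [T, Matrix.mulVecLin_apply, Matrix.mulVec, dotProduct, Matrix.of_apply] at this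
        rw [← Polynomial.coe_compRingHom_apply, map_sum, Polynomial.finsetSum_coeff]
        refine Eq.trans (Finset.sum_congr rfl fun b _ => ?_) this
        simp [mul_comm (v b)]
    funext b
    have := congrArg (fun P => P.coeff (b : ℕ)) hP
    simpa [Polynomial.finsetSum_coeff, Polynomial.coeff_C_mul, Polynomial.coeff_X_pow,
      Fin.val_inj] using this
  obtain ⟨S, hS⟩ := LinearMap.exists_leftInverse_of_injective T hT
  refine ⟨fun b γ => if hb : b < N then S (Pi.single γ 1) ⟨b, hb⟩ else 0, fun b hb b' hb' => ?_⟩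
  have h1 : S (T (Pi.single ⟨b', hb'⟩ 1)) ⟨b, hb⟩ = if b = b' then 1 else 0 := by
    rw [← LinearMap.comp_apply, hS]
    simp [Pi.single_apply]
  rw [← h1, LinearMap.pi_apply_eq_sum_univ S]
  simp only [hb, dif_pos, Finset.sum_apply, Pi.smul_apply, smul_eq_mul]
  refine Finset.sum_congr rfl fun γ _ => ?_
  rw [mul_comm]
  congr 1
  · simp [T]
  · refine congrFun (congrArg S (funext fun γ' => ?_)) _
    simp [Pi.single_apply, eq_comm]

open Polynomial in
theorem algebraMap_add_pow_of_pow_eq_zero {k C' : Type*} [Field k] [CommRing C'] [Algebra k C']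
    {n : C'} {m : ℕ} (hn : n ^ m = 0) (a : k) (b : ℕ) :
    (algebraMap k C' a + n) ^ b =
      ∑ j : Fin m, algebraMap k C' (((X + C a) ^ b : k[X]).coeff j) * n ^ (j : ℕ) := by
  have h1 : (algebraMap k C' a + n) ^ b = aeval n ((X + C a) ^ b : k[X]) := by
    simp [add_comm]
  rw [h1, Polynomial.aeval_eq_sum_range' (n := b + 1 + m) (by simp; omega),
    Fin.sum_univ_eq_sum_range (fun j => algebraMap k C' (((X + C a) ^ b : k[X]).coeff j) * n ^ j)]
  symm
  simp only [Algebra.smul_def]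
  refine Finset.sum_subset (Finset.range_mono (by omega)) fun j _ hj => ?_
  rw [Finset.mem_range, not_lt] at hj
  rw [pow_eq_zero_of_le hj hn, mul_zero]

/-- Commuting elements `n i` with `n i ^ m = 0` behave like independent truncated variables as
soon as the product of their highest nonzero powers does not kill `w`. -/
theorem eq_zero_of_sum_mul_prod_pow_eq_zero {σ k C : Type*} [Fintype σ] [DecidableEq σ] [Field k]
    [CommRing C] [Algebra k C] {m : ℕ} {n : σ → C} {w : C} (hn : ∀ i, n i ^ m = 0)
    (hw : (∏ i, n i ^ (m - 1)) * w ≠ 0) (c : (σ → Fin m) → k)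
    (h : ∑ α, algebraMap k C (c α) * (∏ i, n i ^ (α i : ℕ)) * w = 0) : c = 0 := by
  classical
  by_contra hc
  have hne : {α | c α ≠ 0}.Nonempty := by
    by_contra hne
    rw [Set.not_nonempty_iff_eq_empty] at hne
    refine hc (funext fun α => ?_)
    by_contra h0
    exact (hne ▸ (h0 : α ∈ {α | c α ≠ 0}) : α ∈ (∅ : Set _))
  obtain ⟨α, hα⟩ := (Set.toFinite {α | c α ≠ 0}).exists_minimal hne
  -- Multiplying by the complementary power of `n` kills every exponent that is not below `α`.
  have h2 := congrArg (fun z => (∏ i, n i ^ (m - 1 - (α i : ℕ))) * z) h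
  simp only [mul_zero, Finset.mul_sum] at h2
  rw [Finset.sum_eq_single α] at h2
  · have h3 : algebraMap k C (c α) * ((∏ i, n i ^ (m - 1)) * w) = 0 := by
      rw [← h2]
      have : ∏ i, n i ^ (m - 1) = (∏ i, n i ^ (m - 1 - (α i : ℕ))) * ∏ i, n i ^ (α i : ℕ) := by
        rw [← Finset.prod_mul_distrib]
        refine Finset.prod_congr rfl fun i _ => ?_
        rw [← pow_add]
        congr 1
        have := (α i).2
        omega
      rw [this]
      ring
    have hu : IsUnit (algebraMap k C (c α)) := (Ne.isUnit hα.1).map _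
    exact hw (hu.mul_right_eq_zero.1 h3)
  · intro β _ hβ
    by_cases hcβ : c β = 0
    · simp [hcβ]
    have hnle : ¬ β ≤ α := fun hle => hβ (le_antisymm hle (hα.2 hcβ hle))
    obtain ⟨i, hi⟩ := not_forall.1 hnle
    have hi' : (α i : ℕ) < β i := not_le.1 hi
    have hz : (∏ i, n i ^ (m - 1 - (α i : ℕ))) * ∏ i, n i ^ (β i : ℕ) = 0 := by
      rw [← Finset.prod_mul_distrib]
      refine Finset.prod_eq_zero (Finset.mem_univ i) ?_
      rw [← pow_add]
      exact pow_eq_zero_of_le (by have := (β i).2; omega) (hn i)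
    calc _ = algebraMap k C (c β) *
          ((∏ i, n i ^ (m - 1 - (α i : ℕ))) * ∏ i, n i ^ (β i : ℕ)) * w := by ring
      _ = 0 := by rw [hz]; ring
  · exact fun h => absurd (Finset.mem_univ α) h

theorem MvPolynomial.eq_zero_of_aeval_add_nilpotent_of_fintype {σ k C : Type*} [Fintype σ]
    [Field k] [Finite k] [CommRing C] [Algebra k C] {m : ℕ} {f : MvPolynomial σ k}
    (hf : ∀ b ∈ f.support, ∀ i, b i < Nat.card k * m) {n : σ → C} {w : C}
    (hn : ∀ i, n i ^ m = 0) (hw : (∏ i, n i ^ (m - 1)) * w ≠ 0)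
    (h : ∀ a : σ → k, MvPolynomial.aeval (fun i => algebraMap k C (a i) + n i) f * w = 0) :
    f = 0 := by
  classical
  have := Fintype.ofFinite k
  rw [Nat.card_eq_fintype_card] at hf
  obtain ⟨L, hL⟩ := exists_coeff_eq_sum_taylor k m
  let M : ℕ → k × Fin m → k := fun b γ => ((Polynomial.X + Polynomial.C γ.1) ^ b).coeff γ.2
  -- All Taylor coefficients of `f` of order less than `m` in each variable vanish.
  have key : ∀ (a : σ → k) (α : σ → Fin m),
      ∑ b ∈ f.support, f.coeff b * ∏ i, M (b i) (a i, α i) = 0 := by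
    intro a
    refine fun α => congrFun (eq_zero_of_sum_mul_prod_pow_eq_zero hn hw
      (fun α => ∑ b ∈ f.support, f.coeff b * ∏ i, M (b i) (a i, α i)) ?_) α
    rw [← h a, MvPolynomial.aeval_def, MvPolynomial.eval₂_eq', Finset.sum_mul]
    simp only [algebraMap_add_pow_of_pow_eq_zero (hn _), Finset.prod_univ_sum, map_sum, map_mul,
      map_prod, Finset.sum_mul, Finset.mul_sum, Fintype.piFinset_univ]
    rw [Finset.sum_comm]
    refine Finset.sum_congr rfl fun b _ => Finset.sum_congr rfl fun α _ => ?_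
    rw [Finset.prod_mul_distrib]
    simp only [M]
    ring
  ext b₀
  rw [MvPolynomial.coeff_zero]
  by_contra hb₀
  have hb₀ : b₀ ∈ f.support := MvPolynomial.mem_support_iff.2 hb₀
  have h1 : ∑ γ : σ → k × Fin m, (∏ i, L (b₀ i) (γ i)) *
      ∑ b ∈ f.support, f.coeff b * ∏ i, M (b i) (γ i) = 0 :=
    Finset.sum_eq_zero fun γ _ => by
      rw [key (fun i => (γ i).1) (fun i => (γ i).2), mul_zero]
  -- The product over the variables of the univariate coefficient functionals extracts the
  -- coefficient of the monomial `b₀`.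
  have h2 : ∑ γ : σ → k × Fin m, (∏ i, L (b₀ i) (γ i)) *
      ∑ b ∈ f.support, f.coeff b * ∏ i, M (b i) (γ i) =
      ∑ b ∈ f.support, f.coeff b * ∏ i, ∑ γ, L (b₀ i) γ * M (b i) γ := by
    simp only [Finset.prod_univ_sum, Finset.mul_sum, Fintype.piFinset_univ]
    rw [Finset.sum_comm]
    refine Finset.sum_congr rfl fun b _ => Finset.sum_congr rfl fun γ _ => ?_
    rw [Finset.prod_mul_distrib]
    ring
  rw [h2, Finset.sum_eq_single b₀] at h1
  · rw [Finset.prod_congr rfl fun i _ => (hL _ (hf b₀ hb₀ i) _ (hf b₀ hb₀ i)).trans (if_pos rfl),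
      Finset.prod_const_one, mul_one] at h1
    exact MvPolynomial.mem_support_iff.1 hb₀ h1
  · intro b hb hne
    obtain ⟨i, hi⟩ := DFunLike.ne_iff.1 hne
    rw [Finset.prod_eq_zero (Finset.mem_univ i)
      ((hL _ (hf b₀ hb₀ i) _ (hf b hb i)).trans (if_neg hi.symm)), mul_zero]
  · exact fun h => absurd hb₀ h

/-- A polynomial with all exponents less than `|k| * m` is determined by its values, up to a
factor `w`, at the points `a + n`, where `a` runs over the `k`-rational points and `n` is a fixed
tuple of elements that are nilpotent of exact order `m`, independently of each other. -/
theorem MvPolynomial.eq_zero_of_aeval_add_nilpotent {σ k C : Type*} [Field k] [Finite k]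
    [CommRing C] [Algebra k C] {m : ℕ} {f : MvPolynomial σ k}
    (hf : ∀ b ∈ f.support, ∀ i, b i < Nat.card k * m) {n : σ → C} {w : C}
    (hn : ∀ i, n i ^ m = 0) (hw : ∀ s : Finset σ, (∏ i ∈ s, n i ^ (m - 1)) * w ≠ 0)
    (h : ∀ a : σ → k, MvPolynomial.aeval (fun i => algebraMap k C (a i) + n i) f * w = 0) :
    f = 0 := by
  classical
  obtain ⟨d, g, hg, f, rfl⟩ := f.exists_fin_rename
  suffices hf0 : f = 0 by rw [hf0, map_zero]
  refine MvPolynomial.eq_zero_of_aeval_add_nilpotent_of_fintype (n := n ∘ g) (w := w) (m := m)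
    (fun b hb i => ?_) (fun i => hn _) ?_ fun a => ?_
  · have := hf (b.mapDomain g) ?_ (g i)
    · rwa [Finsupp.mapDomain_apply hg] at this
    · rw [MvPolynomial.mem_support_iff] at hb ⊢
      rwa [MvPolynomial.coeff_rename_mapDomain g hg]
  · have := hw (Finset.univ.image g)
    rwa [Finset.prod_image hg.injOn] at this
  · have := h (Function.extend g a 0)
    rw [MvPolynomial.aeval_rename] at this
    convert this using 4 with i
    funext j
    simp [hg.extend_apply]

end PolynomialSeparation

section CommutativeAlgebra

theorem sum_pow_card_of_mul_self_eq_zero {ι R : Type*} [CommRing R] (s : Finset ι) (z : ι → R)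
    (hz : ∀ i, z i * z i = 0) :
    (∑ i ∈ s, z i) ^ s.card = (s.card.factorial : R) * ∏ i ∈ s, z i := by
  classical
  induction s using Finset.induction_on with
  | empty => simp
  | insert a s ha ih =>
    have h0 : (∑ i ∈ s, z i) ^ (s.card + 1) = 0 := by
      rw [pow_succ, ih, mul_assoc, Finset.mul_sum]
      rw [Finset.sum_eq_zero, mul_zero]
      intro i hi
      rw [← Finset.mul_prod_erase s z hi, mul_right_comm, hz, zero_mul]
    have h1 : ∀ (n : ℕ) (S : R), (z a + S) ^ (n + 1) = S ^ (n + 1) + (n + 1) * z a * S ^ n := by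
      intro n S
      induction n with
      | zero => simp [add_comm]
      | succ n ihn =>
        rw [pow_succ, ihn]
        push_cast
        linear_combination ((n : R) + 1) * S ^ n * hz a
    rw [Finset.sum_insert ha, Finset.prod_insert ha, Finset.card_insert_of_notMem ha, h1, h0, ih,
      Nat.factorial_succ]
    push_cast
    ring

theorem MvPolynomial.aeval_mul_eq_of_forall_mul_eq {σ k C : Type*} [CommRing k] [CommRing C]
    [Algebra k C] {y y' : σ → C} {w : C} (h : ∀ i, y i * w = y' i * w) (f : MvPolynomial σ k) :
    MvPolynomial.aeval y f * w = MvPolynomial.aeval y' f * w := by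
  induction f using MvPolynomial.induction_on with
  | C r => simp
  | add f g hf hg => rw [map_add, map_add, add_mul, add_mul, hf, hg]
  | mul_X f i hf =>
    rw [map_mul, map_mul, aeval_X, aeval_X, mul_assoc, h, mul_left_comm, hf]
    ring

end CommutativeAlgebra

/-! ### The Grassmann algebra: parity, commutators and products of generators -/

section Grassmann

open ExteriorAlgebra

variable {k V : Type*} [Field k] [AddCommGroup V] [Module k V]

/-- Moving a vector past an element of the exterior algebra applies the grade involution, whose
eigenvectors for `1` and `-1` are the even and the odd elements. -/
theorem ExteriorAlgebra.ι_mul_eq_involute_mul (v : V) (g : ExteriorAlgebra k V) :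
    ι k v * g = CliffordAlgebra.involute g * ι k v := by
  induction g using ExteriorAlgebra.induction with
  | algebraMap r => rw [AlgHom.commutes, Algebra.commutes]
  | ι w =>
    change _ = CliffordAlgebra.involute (CliffordAlgebra.ι 0 w) * _
    rw [CliffordAlgebra.involute_ι]
    exact eq_neg_of_add_eq_zero_left (ι_add_mul_swap v w) |>.trans (neg_mul _ _).symm
  | mul a b ha hb => rw [← mul_assoc, ha, mul_assoc, hb, map_mul, mul_assoc]
  | add a b ha hb => rw [mul_add, ha, hb, map_add, add_mul]

/-- Even elements of the exterior algebra are central. -/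
theorem ExteriorAlgebra.commute_of_involute_eq {a : ExteriorAlgebra k V}
    (ha : CliffordAlgebra.involute a = a) (b : ExteriorAlgebra k V) : Commute a b := by
  induction b using ExteriorAlgebra.induction with
  | algebraMap r => exact (Algebra.commutes r a).symm
  | ι w => exact ((ι_mul_eq_involute_mul w a).trans (by rw [ha])).symm
  | mul b c hb hc => exact hb.mul_right hc
  | add b c hb hc => exact hb.add_right hc

/-- Moving an odd element past any element applies the grade involution; in particular, odd
elements anticommute. -/
theorem ExteriorAlgebra.mul_eq_involute_mul_of_involute_eq_neg {a : ExteriorAlgebra k V}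
    (ha : CliffordAlgebra.involute a = -a) (b : ExteriorAlgebra k V) :
    a * b = CliffordAlgebra.involute b * a := by
  induction b using ExteriorAlgebra.induction with
  | algebraMap r => rw [AlgHom.commutes, Algebra.commutes]
  | ι w =>
    have h := ι_mul_eq_involute_mul w a
    rw [ha] at h
    change _ = CliffordAlgebra.involute (CliffordAlgebra.ι 0 w) * _
    rw [CliffordAlgebra.involute_ι]
    change _ = - ι k w * _
    rw [neg_mul, h, neg_mul, neg_neg]
  | mul b c hb hc => rw [← mul_assoc, hb, mul_assoc, hc, map_mul, mul_assoc]
  | add b c hb hc => rw [mul_add, hb, hc, map_add, add_mul]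

theorem ExteriorAlgebra.mul_comm_of_char_two [CharP k 2] (a b : ExteriorAlgebra k V) :
    a * b = b * a := by
  have h : (CliffordAlgebra.involute : ExteriorAlgebra k V →ₐ[k] ExteriorAlgebra k V) =
      AlgHom.id k _ := by
    refine ExteriorAlgebra.hom_ext (LinearMap.ext fun v => ?_)
    change CliffordAlgebra.involute (CliffordAlgebra.ι 0 v) = ι k v
    rw [CliffordAlgebra.involute_ι]
    change -ι k v = ι k v
    rw [← neg_one_smul k, CharTwo.neg_eq, one_smul]
  exact commute_of_involute_eq (by rw [h]; rfl) b

theorem ExteriorAlgebra.exists_even_add_odd (h2 : (2 : k) ≠ 0) (g : ExteriorAlgebra k V) :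
    ∃ a b, g = a + b ∧ CliffordAlgebra.involute a = a ∧ CliffordAlgebra.involute b = -b := by
  refine ⟨(2⁻¹ : k) • (g + CliffordAlgebra.involute g),
    (2⁻¹ : k) • (g - CliffordAlgebra.involute g), ?_, ?_, ?_⟩
  · rw [← smul_add, add_add_sub_cancel, ← two_smul k g, smul_smul, inv_mul_cancel₀ h2, one_smul]
  · rw [map_smul, map_add, CliffordAlgebra.involute_involute, add_comm]
  · rw [map_smul, map_sub, CliffordAlgebra.involute_involute, ← smul_neg, neg_sub]

/-- Every commutator in the exterior algebra is twice the product of two odd elements. -/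
theorem ExteriorAlgebra.exists_lie_eq (h2 : (2 : k) ≠ 0) (x y : ExteriorAlgebra k V) :
    ∃ a b : ExteriorAlgebra k V, CliffordAlgebra.involute a = -a ∧
      CliffordAlgebra.involute b = -b ∧ ⁅x, y⁆ = 2 * (a * b) := by
  obtain ⟨x₀, x₁, rfl, hx₀, hx₁⟩ := exists_even_add_odd h2 x
  obtain ⟨y₀, y₁, rfl, hy₀, hy₁⟩ := exists_even_add_odd h2 y
  refine ⟨x₁, y₁, hx₁, hy₁, ?_⟩
  have h1 := (commute_of_involute_eq hx₀ y₀).eq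
  have h3 := (commute_of_involute_eq hx₀ y₁).eq
  have h4 := (commute_of_involute_eq hy₀ x₁).eq
  have h5 := mul_eq_involute_mul_of_involute_eq_neg hy₁ x₁
  rw [hx₁, neg_mul] at h5
  rw [Ring.lie_def, add_mul, mul_add, mul_add, add_mul, mul_add, mul_add, h1, h3, h4, h5, two_mul]
  abel

theorem ExteriorAlgebra.mul_self_eq_zero_of_odd (h2 : (2 : k) ≠ 0) {a : ExteriorAlgebra k V}
    (ha : CliffordAlgebra.involute a = -a) : a * a = 0 := by
  have h := mul_eq_involute_mul_of_involute_eq_neg ha a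
  rw [ha, neg_mul, eq_neg_iff_add_eq_zero, ← two_smul k] at h
  exact (smul_eq_zero_iff_right h2).1 h

theorem ExteriorAlgebra.lie_lie_eq_zero (h2 : (2 : k) ≠ 0) (x y z : ExteriorAlgebra k V) :
    ⁅⁅x, y⁆, z⁆ = 0 := by
  obtain ⟨a, b, ha, hb, h⟩ := exists_lie_eq h2 x y
  rw [h, Ring.lie_def, sub_eq_zero]
  refine commute_of_involute_eq ?_ z
  rw [map_mul, map_mul, ha, hb, neg_mul_neg, map_ofNat]

theorem ExteriorAlgebra.lie_mul_self_eq_zero (h2 : (2 : k) ≠ 0) (x y : ExteriorAlgebra k V) :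
    ⁅x, y⁆ * ⁅x, y⁆ = 0 := by
  obtain ⟨a, b, ha, hb, h⟩ := exists_lie_eq h2 x y
  have hba := mul_eq_involute_mul_of_involute_eq_neg hb a
  rw [ha, neg_mul] at hba
  have : a * b * (a * b) = 0 := by
    rw [mul_assoc, ← mul_assoc b, hba, neg_mul, mul_neg, ← mul_assoc, ← mul_assoc,
      mul_self_eq_zero_of_odd h2 ha, zero_mul, zero_mul, neg_zero]
  rw [h, two_mul, add_mul, mul_add, this]
  simp

/-- Products of distinct basis vectors are nonzero: a determinant is a functional that detects
them. -/
theorem ExteriorAlgebra.prod_map_ι_single_ne_zero {I : Type*} {l : List I} (hl : l.Nodup) :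
    (l.map fun i => ι k (Finsupp.single i (1 : k))).prod ≠ 0 := by
  classical
  intro h
  let D : (I →₀ k) [⋀^Fin l.length]→ₗ[k] k :=
    (Matrix.detRowAlternating (R := k) (n := Fin l.length)).compLinearMap
      (LinearMap.pi fun i => Finsupp.lapply (l.get i))
  have hD : D (fun i => Finsupp.single (l.get i) 1) = 1 := by
    change Matrix.det (Matrix.of fun i j : Fin l.length =>
      Finsupp.single (l.get i) (1 : k) (l.get j)) = 1
    suffices h1 : (Matrix.of fun i j : Fin l.length =>
        Finsupp.single (l.get i) (1 : k) (l.get j)) = 1 by rw [h1, Matrix.det_one]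
    ext i j
    rw [Matrix.of_apply, Matrix.one_apply, Finsupp.single_apply]
    exact if_congr hl.get_inj_iff rfl rfl
  have h1 : ιMulti k l.length (fun i => Finsupp.single (l.get i) (1 : k)) = 0 := by
    rw [ιMulti_apply, ← h]
    exact congrArg List.prod
      (List.ofFn_getElem_eq_map l fun i => ι k (Finsupp.single i (1 : k)))
  let F : ∀ i, (I →₀ k) [⋀^Fin i]→ₗ[k] k := Function.update 0 l.length D
  have h2 := liftAlternating_apply_ιMulti F fun i => Finsupp.single (l.get i) (1 : k)
  rw [h1, map_zero] at h2
  simp only [F, Function.update_self] at h2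
  rw [hD] at h2
  exact zero_ne_one h2

end Grassmann

/-! ### The symmetrized algebra of a ring with central commutators -/

section SymmetrizedAlgebra

theorem SymAlg.sym_apply_unsym {A : Type*} (z : Aˢʸᵐ) : SymAlg.sym (SymAlg.unsym z) = z := rfl

/-- A ring in which all commutators are central. -/
class HasCentralCommutators (A : Type*) [Ring A] : Prop where
  lie_lie_eq_zero : ∀ a b c : A, ⁅⁅a, b⁆, c⁆ = 0

theorem lie_mul_eq {A : Type*} [Ring A] (a b c : A) : ⁅a, b * c⁆ = ⁅a, b⁆ * c + b * ⁅a, c⁆ := by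
  simp only [Ring.lie_def]; noncomm_ring

section Ring

variable {A : Type*} [Ring A] [HasCentralCommutators A]

theorem commute_lie (a b c : A) : Commute ⁅a, b⁆ c :=
  sub_eq_zero.1 ((Ring.lie_def _ _).symm.trans (HasCentralCommutators.lie_lie_eq_zero a b c))

/-- The identity that makes products of commutators alternating: it is the Leibniz rule applied to
the central element `⁅a, b * c⁆`. -/
theorem lie_mul_lie_add (a b c d : A) : ⁅a, b⁆ * ⁅c, d⁆ + ⁅a, c⁆ * ⁅b, d⁆ = 0 := by
  have h := (commute_lie a (b * c) d).eq
  rw [lie_mul_eq] at h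
  have h1 := (commute_lie a b d).eq
  have h2 := (commute_lie a c d).eq
  have h3 := (commute_lie a c (b * d - d * b)).eq
  calc ⁅a, b⁆ * ⁅c, d⁆ + ⁅a, c⁆ * ⁅b, d⁆
      = (⁅a, b⁆ * c + b * ⁅a, c⁆) * d - d * (⁅a, b⁆ * c + b * ⁅a, c⁆)
        - (⁅a, b⁆ * d - d * ⁅a, b⁆) * c - b * (⁅a, c⁆ * d - d * ⁅a, c⁆)
        + (⁅a, c⁆ * (b * d - d * b) - (b * d - d * b) * ⁅a, c⁆) := by
          rw [Ring.lie_def c d, Ring.lie_def b d]; noncomm_ring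
    _ = 0 := by rw [h, h1, h2, h3]; noncomm_ring

variable [Invertible (2 : A)]

/-- If all commutators of `A` are central, then the symmetrized product
`(a * b + b * a) / 2` is associative: the associator of `a, b, c` is a multiple of `⁅b, ⁅a, c⁆⁆`. -/
instance SymAlg.instCommRing : CommRing Aˢʸᵐ :=
  { (inferInstance : NonAssocRing Aˢʸᵐ) with
    mul_comm := SymAlg.mul_comm
    mul_assoc := fun a b c => by
      have h2 : ∀ z : A, Commute (⅟2 : A) z := fun z => (Commute.ofNat_left 2 z).invOf_left
      have hb := (commute_lie a.unsym c.unsym b.unsym).eq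
      rw [Ring.lie_def] at hb
      apply SymAlg.unsym_injective
      simp only [SymAlg.unsym_mul]
      generalize a.unsym = a, b.unsym = b, c.unsym = c, (⅟2 : A) = t at h2 hb ⊢
      have e1 : ∀ z w : A, z * (t * w) = t * (z * w) := fun z w => by
        rw [← mul_assoc, ← (h2 z).eq, mul_assoc]
      rw [mul_assoc t, e1 c, e1 a, mul_assoc t (b * c + c * b) a, ← mul_add, ← mul_add]
      congr 2
      rw [← sub_eq_zero]
      calc (a * b + b * a) * c + c * (a * b + b * a) - (a * (b * c + c * b) + (b * c + c * b) * a)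
          = b * (a * c - c * a) - (a * c - c * a) * b := by noncomm_ring
        _ = 0 := by rw [hb, sub_self] }

omit [HasCentralCommutators A] in
theorem SymAlg.sym_mul (a b : A) :
    SymAlg.sym (a * b) = SymAlg.sym a * SymAlg.sym b + SymAlg.sym (⅟2 * ⁅a, b⁆) := by
  rw [SymAlg.sym_mul_sym, ← SymAlg.sym_add, ← mul_add, Ring.lie_def]
  congr 1
  rw [add_add_sub_cancel, ← two_mul, invOf_mul_cancel_left]

omit [HasCentralCommutators A] in
theorem SymAlg.sym_mul_of_commute {a b : A} (h : Commute a b) :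
    SymAlg.sym (a * b) = SymAlg.sym a * SymAlg.sym b := by
  rw [SymAlg.sym_mul, Ring.lie_def, h.eq, sub_self, mul_zero, SymAlg.sym_zero, add_zero]

theorem SymAlg.sym_pow (a : A) (n : ℕ) : SymAlg.sym (a ^ n) = SymAlg.sym a ^ n := by
  induction n with
  | zero => simp
  | succ n ih => rw [pow_succ, pow_succ, ← ih, sym_mul_of_commute (Commute.pow_self a n)]

variable {k : Type*} [Field k] [Algebra k A]

instance SymAlg.instAlgebra : Algebra k Aˢʸᵐ :=
  Algebra.ofModule
    (fun r z w => SymAlg.unsym_injective <| by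
      simp only [SymAlg.unsym_mul, SymAlg.unsym_smul, smul_mul_assoc, mul_smul_comm, ← smul_add])
    (fun r z w => SymAlg.unsym_injective <| by
      simp only [SymAlg.unsym_mul, SymAlg.unsym_smul, smul_mul_assoc, mul_smul_comm, ← smul_add])

/-- The map `⁅a, ·⁆`, as a derivation of the symmetrized algebra. -/
def SymAlg.lieDerivation (k : Type*) [Field k] [Algebra k A] (a : A) :
    Derivation k Aˢʸᵐ Aˢʸᵐ :=
  Derivation.mk'
    { toFun := fun z => SymAlg.sym ⁅a, z.unsym⁆
      map_add' := fun z w => SymAlg.unsym_injective <| by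
        simp only [Ring.lie_def, SymAlg.unsym_sym, SymAlg.unsym_add]; noncomm_ring
      map_smul' := fun r z => SymAlg.unsym_injective <| by
        simp only [Ring.lie_def, SymAlg.unsym_sym, SymAlg.unsym_smul, RingHom.id_apply,
          mul_smul_comm, smul_mul_assoc, smul_sub] }
    fun z w => by
      have h2 : ∀ z : A, Commute (⅟2 : A) z := fun z => (Commute.ofNat_left 2 z).invOf_left
      apply SymAlg.unsym_injective
      simp only [LinearMap.coe_mk, AddHom.coe_mk, smul_eq_mul, SymAlg.unsym_mul,
        SymAlg.unsym_add, SymAlg.unsym_sym]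
      generalize z.unsym = z, w.unsym = w, (⅟2 : A) = t at h2 ⊢
      rw [lie_mul_eq, ← mul_add, Ring.lie_def a t, (h2 a).eq, sub_self, zero_mul, zero_add]
      congr 1
      simp only [Ring.lie_def]
      noncomm_ring

theorem SymAlg.lieDerivation_apply (a : A) (z : Aˢʸᵐ) :
    SymAlg.lieDerivation k a z = SymAlg.sym ⁅a, z.unsym⁆ := rfl

theorem SymAlg.sym_algebraMap (r : k) :
    SymAlg.sym (algebraMap k A r) = algebraMap k Aˢʸᵐ r := by
  rw [Algebra.algebraMap_eq_smul_one, Algebra.algebraMap_eq_smul_one, SymAlg.sym_smul,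
    SymAlg.sym_one]

/-- An algebra homomorphism, as a homomorphism of symmetrized algebras. -/
def SymAlg.mapAlgHom {B : Type*} [Ring B] [HasCentralCommutators B] [Invertible (2 : B)]
    [Algebra k B] (ψ : A →ₐ[k] B) : Aˢʸᵐ →ₐ[k] Bˢʸᵐ :=
  AlgHom.ofLinearMap
    { toFun := fun z => SymAlg.sym (ψ z.unsym)
      map_add' := fun z w => by simp
      map_smul' := fun r z => by simp }
    (by simp)
    (fun z w => by
      have h : ψ (⅟2) = ⅟2 := by
        refine (invOf_eq_right_inv ?_).symm
        rw [← map_ofNat ψ 2, ← map_mul, mul_invOf_self, map_one]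
      simp [SymAlg.mul_def, h])

theorem SymAlg.mapAlgHom_sym {B : Type*} [Ring B] [HasCentralCommutators B] [Invertible (2 : B)]
    [Algebra k B] (ψ : A →ₐ[k] B) (a : A) :
    SymAlg.mapAlgHom ψ (SymAlg.sym a) = SymAlg.sym (ψ a) := rfl

end Ring

end SymmetrizedAlgebra

/-! ### Products of commutators -/

section CommutatorProducts

variable {I A : Type*} [Ring A]

/-- The product `⁅x i₁, x i₂⁆ * ⁅x i₃, x i₄⁆ * ⋯` of commutators over consecutive pairs of entries
of a list; by convention it is `0` for lists of odd length. -/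
def commProd (x : I → A) : List I → A
  | [] => 1
  | [_] => 0
  | i :: j :: l => ⁅x i, x j⁆ * commProd x l

theorem map_commProd {B F : Type*} [Ring B] [FunLike F A B] [RingHomClass F A B] (ψ : F)
    (x : I → A) : ∀ l : List I, ψ (commProd x l) = commProd (fun i => ψ (x i)) l
  | [] => map_one ψ
  | [_] => map_zero ψ
  | i :: j :: l => by
    simp only [commProd, map_mul, map_commProd ψ x l, Ring.lie_def, map_sub]

theorem commProd_eq_zero_of_odd (x : I → A) : ∀ l : List I, Odd l.length → commProd x l = 0
  | [], h => by simp at h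
  | [_], _ => rfl
  | _ :: _ :: l, h => by
    rw [commProd, commProd_eq_zero_of_odd x l (by simpa [Nat.odd_add_one] using h), mul_zero]

theorem commProd_add_of_commute {s : I → A} (hs : ∀ i z, Commute (s i) z) (x : I → A) :
    ∀ l : List I, commProd (fun i => s i + x i) l = commProd x l
  | [] => rfl
  | [_] => rfl
  | i :: j :: l => by
    rw [commProd, commProd, commProd_add_of_commute hs x l]
    congr 1
    rw [Ring.lie_def, Ring.lie_def, add_mul, mul_add, mul_add, add_mul, mul_add, mul_add,
      (hs i (s j)).eq, (hs i (x j)).eq, (hs j (x i)).eq]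
    abel

theorem commProd_eq_zero_of_mem {x : I → A} {i : I} (hx : x i = 0) :
    ∀ l : List I, i ∈ l → commProd x l = 0
  | [], h => by simp at h
  | [_], _ => rfl
  | a :: b :: l, h => by
    rw [List.mem_cons, List.mem_cons] at h
    rcases h with rfl | rfl | h
    · simp [commProd, Ring.lie_def, hx]
    · simp [commProd, Ring.lie_def, hx]
    · rw [commProd, commProd_eq_zero_of_mem hx l h, mul_zero]

theorem commProd_congr {x y : I → A} : ∀ l : List I, (∀ i ∈ l, x i = y i) →
    commProd x l = commProd y l
  | [], _ => rfl
  | [_], _ => rfl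
  | a :: b :: l, h => by
    rw [commProd, commProd, h a (by simp), h b (by simp),
      commProd_congr l fun i hi => h i (by simp [hi])]

variable [HasCentralCommutators A]

theorem commute_commProd (x : I → A) (a : A) : ∀ l : List I, Commute (commProd x l) a
  | [] => Commute.one_left a
  | [_] => Commute.zero_left a
  | _ :: _ :: l => (commute_lie _ _ a).mul_left (commute_commProd x a l)

theorem commProd_append_swap (x : I → A) (i j : I) (l : List I) : ∀ pre : List I,
    commProd x (pre ++ i :: j :: l) = -commProd x (pre ++ j :: i :: l)
  | [] => by simp only [List.nil_append, commProd, ← neg_mul, Ring.lie_def, neg_sub]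
  | [a] => by
    cases l with
    | nil => simp [commProd]
    | cons b l =>
      simp only [List.cons_append, List.nil_append, commProd, ← mul_assoc, ← neg_mul]
      rw [eq_neg_of_add_eq_zero_left (lie_mul_lie_add (x a) (x i) (x j) (x b)),
        neg_mul, neg_mul, neg_mul]
  | a :: b :: pre => by
    simp only [List.cons_append, commProd, commProd_append_swap x i j l pre, mul_neg]

/-- Products of commutators are invariant under permutations up to sign. The prefix is there
because `commProd` consumes entries in pairs, so that prepending one entry changes the pairing. -/
theorem commProd_append_eq_or_neg (x : I → A) {l l' : List I} (h : l.Perm l') : ∀ pre : List I,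
    commProd x (pre ++ l) = commProd x (pre ++ l') ∨
      commProd x (pre ++ l) = -commProd x (pre ++ l') := by
  induction h with
  | nil => exact fun pre => Or.inl rfl
  | cons a _ ih => exact fun pre => by simpa using ih (pre ++ [a])
  | swap a b l => exact fun pre => Or.inr (commProd_append_swap x b a l pre)
  | trans _ _ ih₁ ih₂ =>
    intro pre
    rcases ih₁ pre with h₁ | h₁ <;> rcases ih₂ pre with h₂ | h₂ <;> simp [h₁, h₂]

theorem commProd_eq_or_neg_of_perm (x : I → A) {l l' : List I} (h : l.Perm l') :
    commProd x l = commProd x l' ∨ commProd x l = -commProd x l' :=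
  commProd_append_eq_or_neg x h []

theorem commProd_eq_zero_of_not_nodup (x : I → A) {l : List I} (h : ¬ l.Nodup) :
    commProd x l = 0 := by
  obtain ⟨a, ha⟩ := List.exists_duplicate_iff_not_nodup.2 h
  obtain ⟨l', hl'⟩ := (List.duplicate_iff_sublist.1 ha).exists_perm_append
  have : commProd x (a :: a :: l') = 0 := by
    simp [commProd, Ring.lie_def]
  rcases commProd_eq_or_neg_of_perm x hl' with h | h
  · rw [h]; exact this
  · rw [h]; exact neg_eq_zero.2 this

end CommutatorProducts

/-! ### Normal forms -/

section NormalForm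

open MvPolynomial SymAlg

variable {I k A : Type*} [Field k] [Ring A] [HasCentralCommutators A] [Invertible (2 : A)]
  [Algebra k A]

/-- The `k`-span, in the symmetrized algebra, of products of a polynomial in the `x i` and a
product of commutators of the `x i`. -/
def normalSpan (k : Type*) [Field k] [Algebra k A] (x : I → A) : Submodule k Aˢʸᵐ :=
  Submodule.span k (Set.range fun t : MvPolynomial I k × List I =>
    aeval (fun i => sym (x i)) t.1 * sym (commProd x t.2))

theorem aeval_mul_commProd_mem_normalSpan (x : I → A) (f : MvPolynomial I k) (l : List I) :
    aeval (fun i => sym (x i)) f * sym (commProd x l) ∈ normalSpan k x :=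
  Submodule.subset_span ⟨(f, l), rfl⟩

theorem aeval_mul_mem_normalSpan (x : I → A) (f : MvPolynomial I k) {z : Aˢʸᵐ}
    (hz : z ∈ normalSpan k x) : aeval (fun i => sym (x i)) f * z ∈ normalSpan k x := by
  induction hz using Submodule.span_induction with
  | mem z hz =>
    obtain ⟨t, rfl⟩ := hz
    change _ * (_ * _) ∈ _
    rw [← mul_assoc, ← map_mul]
    exact aeval_mul_commProd_mem_normalSpan x _ _
  | zero => rw [mul_zero]; exact zero_mem _
  | add z w _ _ hz hw => rw [mul_add]; exact add_mem hz hw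
  | smul r z _ hz => rw [mul_smul_comm]; exact Submodule.smul_mem _ r hz

theorem lieDerivation_aeval_mul_mem_normalSpan (x : I → A) (i : I) (f : MvPolynomial I k)
    (l : List I) : lieDerivation k (x i) (aeval (fun i => sym (x i)) f) * sym (commProd x l) ∈
      normalSpan k x := by
  induction f using MvPolynomial.induction_on generalizing l with
  | C r =>
    rw [algHom_C, Derivation.map_algebraMap, zero_mul]
    exact zero_mem _
  | add f g hf hg =>
    rw [map_add, map_add, add_mul]
    exact add_mem (hf l) (hg l)
  | mul_X f j hf =>
    rw [map_mul, Derivation.leibniz, add_mul, aeval_X, smul_eq_mul, smul_eq_mul,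
      lieDerivation_apply (a := x i) (z := sym (x j)), unsym_sym]
    refine add_mem ?_ ?_
    · rw [mul_assoc, ← sym_mul_of_commute (commute_lie _ _ _)]
      exact aeval_mul_commProd_mem_normalSpan x f (i :: j :: l)
    · rw [mul_assoc]
      simpa using aeval_mul_mem_normalSpan x (X j) (hf l)

theorem lieDerivation_mem_normalSpan (x : I → A) (i : I) {z : Aˢʸᵐ} (hz : z ∈ normalSpan k x) :
    lieDerivation k (x i) z ∈ normalSpan k x := by
  suffices h : normalSpan k x ≤
      (normalSpan k x).comap (lieDerivation k (x i) : Aˢʸᵐ →ₗ[k] Aˢʸᵐ) from h hz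
  refine Submodule.span_le.2 ?_
  rintro _ ⟨⟨f, l⟩, rfl⟩
  change lieDerivation k (x i) (_ * _) ∈ normalSpan k x
  have h0 : lieDerivation k (x i) (sym (commProd x l)) = 0 := by
    rw [lieDerivation_apply, unsym_sym, Ring.lie_def, (commute_commProd x (x i) l).eq, sub_self,
      sym_zero]
  rw [Derivation.leibniz, h0, smul_zero, zero_add, smul_eq_mul, _root_.mul_comm]
  exact lieDerivation_aeval_mul_mem_normalSpan x i f l

/-- Left multiplication by `x i` is symmetrized multiplication by `x i` plus half the derivation
`⁅x i, ·⁆`, and both preserve the span. -/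
theorem sym_gen_mul_mem_normalSpan (h2 : (2 : k) ≠ 0) (x : I → A) (i : I) {z : Aˢʸᵐ}
    (hz : z ∈ normalSpan k x) : sym (x i * z.unsym) ∈ normalSpan k x := by
  have h : sym (⅟2 * ⁅x i, z.unsym⁆) = (2⁻¹ : k) • lieDerivation k (x i) z := by
    rw [lieDerivation_apply, ← sym_smul]
    congr 1
    rw [invOf_mul_eq_iff_eq_mul_left, two_mul, ← two_smul k, smul_smul, mul_inv_cancel₀ h2,
      one_smul]
  rw [SymAlg.sym_mul, h, sym_apply_unsym]
  refine add_mem ?_ (Submodule.smul_mem _ _ (lieDerivation_mem_normalSpan x i hz))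
  simpa using aeval_mul_mem_normalSpan x (X i) hz

theorem sym_freeAlgebra_mem_normalSpan (h2 : (2 : k) ≠ 0) (π : FreeAlgebra k I →ₐ[k] A)
    (f : FreeAlgebra k I) : sym (π f) ∈ normalSpan k fun i => π (FreeAlgebra.ι k i) := by
  suffices h : ∀ z ∈ normalSpan k fun i => π (FreeAlgebra.ι k i), sym (π f * z.unsym) ∈
      normalSpan k fun i => π (FreeAlgebra.ι k i) by
    simpa using h 1 (by
      simpa [commProd] using
        aeval_mul_commProd_mem_normalSpan (k := k) (fun i => π (FreeAlgebra.ι k i)) 1 [])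
  induction f using FreeAlgebra.induction with
  | grade0 r =>
    intro z hz
    rw [AlgHom.commutes, ← Algebra.smul_def, SymAlg.sym_smul]
    exact Submodule.smul_mem _ r hz
  | grade1 i => exact fun z hz => sym_gen_mul_mem_normalSpan h2 _ i hz
  | mul a b ha hb =>
    intro z hz
    rw [map_mul π, mul_assoc]
    exact ha _ (hb z hz)
  | add a b ha hb =>
    intro z hz
    rw [map_add π, add_mul, SymAlg.sym_add]
    exact add_mem (ha z hz) (hb z hz)

theorem exists_lt_pow_eq_pow {M : Type*} [Monoid M] {N r : ℕ} (hr : r < N)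
    (h : ∀ a : M, a ^ N = a ^ r) (e : ℕ) : ∃ e' < N, ∀ a : M, a ^ e = a ^ e' := by
  induction e using Nat.strong_induction_on with
  | _ e ih =>
    by_cases he : e < N
    · exact ⟨e, he, fun _ => rfl⟩
    · obtain ⟨e', he', h'⟩ := ih (e - N + r) (by omega)
      refine ⟨e', he', fun a => ?_⟩
      rw [← h', pow_add, ← h, ← pow_add]
      congr 1
      omega

/-- Polynomials with all exponents less than `N`. -/
noncomputable def reducedPolynomials (I k : Type*) [Field k] (N : ℕ) :
    Submodule k (MvPolynomial I k) :=
  restrictSupport k {b | ∀ i, b i < N}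

theorem mem_reducedPolynomials {N : ℕ} {f : MvPolynomial I k} :
    f ∈ reducedPolynomials I k N ↔ ∀ b ∈ f.support, ∀ i, b i < N := by
  rw [reducedPolynomials, restrictSupport, AddMonoidAlgebra.mem_supported]
  rfl

/-- If the powers of all elements are periodic from exponent `r` on, with `a ^ N = a ^ r`, then
polynomials may be replaced by reduced ones when they are evaluated. -/
theorem exists_reduced_aeval_eq {C : Type*} [CommRing C] [Algebra k C] {N r : ℕ} (hr : r < N)
    (y : I → C) (h : ∀ a : C, a ^ N = a ^ r) (f : MvPolynomial I k) :
    ∃ g ∈ reducedPolynomials I k N, aeval y g = aeval y f := by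
  choose e he hpow using exists_lt_pow_eq_pow hr h
  induction f using MvPolynomial.induction_on' with
  | monomial b c =>
    -- The exponent `0` is kept, because `Finsupp.mapRange` needs a map that preserves `0`.
    refine ⟨monomial (b.mapRange (fun n => if n = 0 then 0 else e n) (by simp)) c, ?_, ?_⟩
    · rw [mem_reducedPolynomials]
      intro b' hb' i
      rw [Finset.mem_singleton.1 (support_monomial_subset hb'), Finsupp.mapRange_apply]
      split_ifs
      · omega
      · exact he _
    · rw [aeval_monomial, aeval_monomial, Finsupp.prod_mapRange_index (by simp)]
      congr 1
      refine Finset.prod_congr rfl fun i hi => ?_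
      dsimp only
      rw [if_neg (Finsupp.mem_support_iff.1 hi), ← hpow]
  | add f g hf hg =>
    obtain ⟨f', hf', hf⟩ := hf
    obtain ⟨g', hg', hg⟩ := hg
    exact ⟨f' + g', add_mem hf' hg', by rw [map_add, map_add, hf, hg]⟩

/-- Every element of the span is a sum of reduced polynomials in the `x i` times products of
commutators, one for each even set of indices. -/
theorem exists_normalForm {N r : ℕ} (hr : r < N) (h : ∀ a : A, a ^ N = a ^ r) (x : I → A)
    {z : Aˢʸᵐ} (hz : z ∈ normalSpan k x) :
    ∃ d : {J : Finset I // Even J.card} →₀ reducedPolynomials I k N,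
      z = d.sum fun J f => aeval (fun i => sym (x i)) f.1 * sym (commProd x J.1.toList) := by
  classical
  let Φ : ({J : Finset I // Even J.card} →₀ reducedPolynomials I k N) →ₗ[k] Aˢʸᵐ :=
    Finsupp.lsum ℕ fun J => (LinearMap.mulRight k (sym (commProd x J.1.toList))).comp
      ((aeval (R := k) fun i => sym (x i)).toLinearMap.comp (Submodule.subtype _))
  suffices hΦ : normalSpan k x ≤ LinearMap.range Φ by
    obtain ⟨d, rfl⟩ := hΦ hz
    exact ⟨d, rfl⟩
  refine Submodule.span_le.2 ?_
  rintro _ ⟨⟨f, l⟩, rfl⟩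
  dsimp only
  by_cases hl : l.Nodup ∧ Even l.length
  · obtain ⟨hnd, hev⟩ := hl
    have hsym : ∀ a : Aˢʸᵐ, a ^ N = a ^ r := fun a => by
      rw [← sym_apply_unsym a, ← SymAlg.sym_pow, ← SymAlg.sym_pow, h]
    obtain ⟨g, hg, hgf⟩ := exists_reduced_aeval_eq hr (fun i => sym (x i)) hsym f
    let J : {J : Finset I // Even J.card} := ⟨l.toFinset, by rwa [List.toFinset_card_of_nodup hnd]⟩
    have hJ : aeval (fun i => sym (x i)) f * sym (commProd x J.1.toList) ∈ LinearMap.range Φ :=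
      ⟨Finsupp.single J ⟨g, hg⟩, by simp [Φ, hgf]⟩
    rcases commProd_eq_or_neg_of_perm x (List.toFinset_toList hnd).symm with h' | h'
    · rw [h']; exact hJ
    · rw [h', SymAlg.sym_neg, mul_neg]; exact neg_mem hJ
  · have h0 : commProd x l = 0 := by
      by_cases hnd : l.Nodup
      · exact commProd_eq_zero_of_odd x l (Nat.not_even_iff_odd.1 fun he => hl ⟨hnd, he⟩)
      · exact commProd_eq_zero_of_not_nodup x hnd
    rw [h0, SymAlg.sym_zero, mul_zero]
    exact zero_mem _

end NormalForm

/-! ### Powers and commutators in the Grassmann algebra -/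

section GrassmannIdentities

/-- `2` is invertible in every algebra over a field in which `2` is not zero. -/
abbrev invertibleTwoOfAlgebra {k A : Type*} [Field k] [Ring A] [Algebra k A] (h2 : (2 : k) ≠ 0) :
    Invertible (2 : A) where
  invOf := algebraMap k A 2⁻¹
  invOf_mul_self := by
    rw [← map_ofNat (algebraMap k A) 2, ← map_mul, inv_mul_cancel₀ h2, map_one]
  mul_invOf_self := by
    rw [← map_ofNat (algebraMap k A) 2, ← map_mul, mul_inv_cancel₀ h2, map_one]

open ExteriorAlgebra

variable {k V : Type*} [Field k] [AddCommGroup V] [Module k V]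

/-- In odd characteristic `p`, the `p`-th power of an element of the exterior algebra is the `p`-th
power of its scalar part: the `p`-th power map is the Frobenius endomorphism of the symmetrized
algebra, and it kills the generators as well as all commutators, whose squares vanish. -/
theorem ExteriorAlgebra.pow_char_of_odd {p : ℕ} [Fact p.Prime] [CharP k p] (h2 : (2 : k) ≠ 0)
    (g : ExteriorAlgebra k V) : g ^ p = algebraMap k _ (algebraMapInv g ^ p) := by
  have hp := (Fact.out : p.Prime)
  have : HasCentralCommutators (ExteriorAlgebra k V) := ⟨lie_lie_eq_zero h2⟩
  let := invertibleTwoOfAlgebra (A := ExteriorAlgebra k V) h2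
  have : CharP (ExteriorAlgebra k V)ˢʸᵐ p :=
    charP_of_injective_algebraMap (algebraMap k (ExteriorAlgebra k V)ˢʸᵐ).injective p
  induction g using ExteriorAlgebra.induction with
  | algebraMap r => rw [← map_pow, ExteriorAlgebra.algebraMap_leftInverse V r]
  | ι v =>
    have h : algebraMapInv (ι k v) = 0 := by simp [algebraMapInv]
    rw [h, zero_pow hp.ne_zero, map_zero]
    exact pow_eq_zero_of_le hp.two_le ((pow_two _).trans (ι_sq_zero v))
  | mul a b ha hb =>
    apply SymAlg.sym_injective
    have h0 : SymAlg.sym (⅟2 * ⁅a, b⁆) ^ p = 0 := by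
      rw [← SymAlg.sym_pow, (Commute.ofNat_left 2 ⁅a, b⁆).invOf_left.mul_pow,
        pow_eq_zero_of_le hp.two_le ((pow_two _).trans (lie_mul_self_eq_zero h2 a b)), mul_zero,
        SymAlg.sym_zero]
    rw [SymAlg.sym_pow, SymAlg.sym_mul, add_pow_char, h0, add_zero, mul_pow, ← SymAlg.sym_pow,
      ← SymAlg.sym_pow, ha, hb, map_mul, mul_pow, map_mul, SymAlg.sym_algebraMap,
      SymAlg.sym_algebraMap, SymAlg.sym_mul_of_commute (Algebra.commutes _ _),
      SymAlg.sym_algebraMap, SymAlg.sym_algebraMap]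
  | add a b ha hb =>
    apply SymAlg.sym_injective
    rw [SymAlg.sym_pow, SymAlg.sym_add, add_pow_char, ← SymAlg.sym_pow, ← SymAlg.sym_pow, ha, hb,
      map_add, add_pow_char, map_add, SymAlg.sym_add]

theorem ExteriorAlgebra.pow_two_of_char_two [CharP k 2] (g : ExteriorAlgebra k V) :
    g ^ 2 = algebraMap k _ (algebraMapInv g ^ 2) := by
  have : CharP (ExteriorAlgebra k V) 2 :=
    charP_of_injective_algebraMap (algebraMap k (ExteriorAlgebra k V)).injective 2
  induction g using ExteriorAlgebra.induction with
  | algebraMap r => rw [← map_pow, ExteriorAlgebra.algebraMap_leftInverse V r]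
  | ι v =>
    have h : algebraMapInv (ι k v) = 0 := by simp [algebraMapInv]
    rw [h, zero_pow two_ne_zero, map_zero, pow_two, ι_sq_zero]
  | mul a b ha hb =>
    rw [Commute.mul_pow (mul_comm_of_char_two a b), ha, hb, map_mul, mul_pow, map_mul]
  | add a b ha hb =>
    rw [add_pow_char_of_commute (p := 2) (mul_comm_of_char_two a b), ha, hb, map_add,
      add_pow_char, map_add]

theorem ExteriorAlgebra.pow_card_mul_char [Finite k] {p : ℕ} [Fact p.Prime] [CharP k p]
    (g : ExteriorAlgebra k V) : g ^ (Nat.card k * p) = g ^ p := by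
  have := Fintype.ofFinite k
  have h : g ^ p = algebraMap k _ (algebraMapInv g ^ p) := by
    by_cases h2 : (2 : k) = 0
    · obtain rfl : p = 2 := (Nat.prime_dvd_prime_iff_eq Fact.out Nat.prime_two).1
        ((CharP.cast_eq_zero_iff k p 2).1 (by exact_mod_cast h2))
      exact pow_two_of_char_two g
    · exact pow_char_of_odd h2 g
  rw [mul_comm, pow_mul, h, ← map_pow, Nat.card_eq_fintype_card, FiniteField.pow_card]

theorem ExteriorAlgebra.lie_ι_ι (v w : V) : ⁅ι k v, ι k w⁆ = 2 * (ι k v * ι k w) := by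
  rw [Ring.lie_def, eq_neg_of_add_eq_zero_right (ι_add_mul_swap v w), sub_neg_eq_add, two_mul]

theorem ExteriorAlgebra.commute_ι_mul_ι (v w : V) (g : ExteriorAlgebra k V) :
    Commute (ι k v * ι k w) g := by
  refine commute_of_involute_eq ?_ g
  change CliffordAlgebra.involute (CliffordAlgebra.ι 0 v * CliffordAlgebra.ι 0 w) = _
  rw [map_mul, CliffordAlgebra.involute_ι, CliffordAlgebra.involute_ι]
  exact neg_mul_neg _ _

theorem ExteriorAlgebra.ι_mul_prod_map_ι_eq_zero {I : Type*} (v : I → V) {i : I} {l : List I}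
    (hi : i ∈ l) : ι k (v i) * (l.map fun j => ι k (v j)).prod = 0 := by
  induction l with
  | nil => simp at hi
  | cons j l ih =>
    rw [List.map_cons, List.prod_cons, ← mul_assoc]
    rcases List.mem_cons.1 hi with rfl | hi
    · rw [ι_sq_zero, zero_mul]
    · rw [eq_neg_of_add_eq_zero_left (ι_add_mul_swap (v i) (v j)), neg_mul, mul_assoc, ih hi,
        mul_zero, neg_zero]

theorem commProd_ι {I : Type*} (v : I → V) : ∀ l : List I, Even l.length →
    commProd (fun i => ι k (v i)) l =
      algebraMap k _ (2 ^ (l.length / 2)) * (l.map fun i => ι k (v i)).prod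
  | [], _ => by simp [commProd]
  | [_], h => by simp at h
  | i :: j :: l, h => by
    have hl : (i :: j :: l).length / 2 = l.length / 2 + 1 := by
      simp only [List.length_cons]; omega
    rw [commProd, commProd_ι v l (by simpa [Nat.even_add_one] using h), lie_ι_ι, hl, pow_succ,
      map_mul, map_ofNat]
    simp only [List.map_cons, List.prod_cons]
    rw [mul_assoc 2, mul_assoc (algebraMap k _ _) 2, ← mul_assoc (ι k (v i) * _),
      ← Algebra.commutes, mul_assoc (algebraMap k _ _), ← mul_assoc 2,
      ← map_ofNat (algebraMap k (ExteriorAlgebra k V)) 2, Algebra.commutes, mul_assoc, mul_assoc]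

end GrassmannIdentities

/-! ### Generic substitutions from the Grassmann algebra -/

section Independence

open ExteriorAlgebra SymAlg MvPolynomial

variable {k : Type*} [Field k]

/-- Generators of the Grassmann algebra, indexed as needed for generic substitutions: an odd
generator for each variable `i`, and countably many pairs of generators for each variable. -/
noncomputable def grassmannGen (k : Type*) [Field k] (t : ℕ ⊕ (ℕ × ℕ × Bool)) : InfGrassmann k :=
  ι k (Finsupp.single (Encodable.encode t) (1 : k))

theorem prod_map_grassmannGen_ne_zero {l : List (ℕ ⊕ (ℕ × ℕ × Bool))} (hl : l.Nodup) :
    (l.map (grassmannGen k)).prod ≠ 0 := by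
  have := prod_map_ι_single_ne_zero (k := k) (hl.map Encodable.encode_injective)
  rwa [List.map_map] at this

/-- The `j`-th even element of square zero attached to the variable `i`. -/
noncomputable def grassmannPair (k : Type*) [Field k] (t : ℕ × ℕ) : InfGrassmann k :=
  grassmannGen k (Sum.inr (t.1, t.2, false)) * grassmannGen k (Sum.inr (t.1, t.2, true))

theorem commute_grassmannPair (t : ℕ × ℕ) (g : InfGrassmann k) : Commute (grassmannPair k t) g :=
  commute_ι_mul_ι _ _ g

theorem grassmannPair_mul_self (t : ℕ × ℕ) : grassmannPair k t * grassmannPair k t = 0 := by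
  unfold grassmannPair grassmannGen
  rw [← mul_assoc, (commute_ι_mul_ι _ _ _).eq, ← mul_assoc, ι_sq_zero, zero_mul, zero_mul]

/-- The generators occurring in a list of pairs. -/
def pairIndices (L : List (ℕ × ℕ)) : List (ℕ ⊕ (ℕ × ℕ × Bool)) :=
  L.flatMap fun t => [Sum.inr (t.1, t.2, false), Sum.inr (t.1, t.2, true)]

theorem nodup_pairIndices_append {L : List (ℕ × ℕ)} (hL : L.Nodup) {l : List ℕ} (hl : l.Nodup) :
    (pairIndices L ++ l.map Sum.inl).Nodup := by
  rw [List.nodup_append]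
  refine ⟨?_, hl.map Sum.inl_injective, ?_⟩
  · rw [pairIndices, List.nodup_flatMap]
    refine ⟨fun t _ => by simp, hL.imp fun {a b} hab => ?_⟩
    simp [Function.onFun, List.disjoint_left]
    grind
  · simp [pairIndices]

theorem prod_map_pairIndices (L : List (ℕ × ℕ)) :
    ((pairIndices L).map (grassmannGen k)).prod = (L.map (grassmannPair k)).prod := by
  induction L with
  | nil => simp [pairIndices]
  | cons t L ih =>
    rw [List.map_cons, List.prod_cons, ← ih]
    simp [pairIndices, grassmannPair, mul_assoc]

theorem prod_sym_grassmannPair_mul_sym [HasCentralCommutators (InfGrassmann k)]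
    [Invertible (2 : InfGrassmann k)] (L : List (ℕ × ℕ)) (g : InfGrassmann k) :
    (L.map fun t => sym (grassmannPair k t)).prod * sym g =
      sym ((L.map (grassmannPair k)).prod * g) := by
  induction L with
  | nil => simp
  | cons t L ih =>
    rw [List.map_cons, List.prod_cons, mul_assoc, ih,
      ← sym_mul_of_commute (commute_grassmannPair t _), List.map_cons, List.prod_cons, mul_assoc]

/-- The nilpotent part, of exact nilpotency order `p`, of the generic value of the variable `i`. -/
noncomputable def grassmannNil (k : Type*) [Field k] (p i : ℕ) : InfGrassmann k :=
  ∑ j ∈ Finset.range (p - 1), grassmannPair k (i, j)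

theorem commute_grassmannNil (p i : ℕ) (g : InfGrassmann k) : Commute (grassmannNil k p i) g :=
  Commute.sum_left _ _ _ fun _ _ => commute_grassmannPair _ g

theorem grassmannNil_pow {p : ℕ} [Fact p.Prime] [CharP k p] (h2 : (2 : k) ≠ 0) (i : ℕ) :
    grassmannNil k p i ^ p = 0 := by
  have h : algebraMapInv (grassmannNil k p i) = 0 := by
    rw [grassmannNil, map_sum]
    exact Finset.sum_eq_zero fun j _ => by simp [grassmannPair, grassmannGen, algebraMapInv]
  rw [pow_char_of_odd h2, h, zero_pow (Fact.out : p.Prime).ne_zero, map_zero]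

/-- The odd part of the generic value of the variable `i`, where only the variables in `J` have
odd parts. -/
noncomputable def grassmannOdd (k : Type*) [Field k] (J : Finset ℕ) (i : ℕ) : InfGrassmann k :=
  if i ∈ J then grassmannGen k (Sum.inl i) else 0

theorem commProd_grassmannOdd {J : Finset ℕ} (hJ : Even J.card) :
    commProd (grassmannOdd k J) J.toList = algebraMap k _ (2 ^ (J.card / 2)) *
      ((J.toList.map Sum.inl).map (grassmannGen k)).prod := by
  rw [commProd_congr (y := fun i => grassmannGen k (Sum.inl i)) J.toList fun i hi => by
    rw [grassmannOdd, if_pos (Finset.mem_toList.1 hi)]]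
  unfold grassmannGen
  rw [commProd_ι
    (fun i => Finsupp.single (Encodable.encode (Sum.inl i : ℕ ⊕ (ℕ × ℕ × Bool))) (1 : k))
    J.toList (by rwa [Finset.length_toList]), Finset.length_toList, List.map_map]
  rfl

theorem grassmannOdd_mul_commProd {J : Finset ℕ} (hJ : Even J.card) (i : ℕ) :
    grassmannOdd k J i * commProd (grassmannOdd k J) J.toList = 0 := by
  rw [commProd_grassmannOdd hJ, grassmannOdd]
  split_ifs with hi
  · rw [← mul_assoc, ← Algebra.commutes, mul_assoc, List.map_map]
    have := ι_mul_prod_map_ι_eq_zero (k := k) (fun i =>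
      Finsupp.single (Encodable.encode (Sum.inl i : ℕ ⊕ (ℕ × ℕ × Bool))) (1 : k))
      (Finset.mem_toList.2 hi)
    rw [grassmannGen]
    refine (congrArg _ ?_).trans (mul_zero _)
    exact this
  · rw [zero_mul]

/-- Up to a nonzero scalar, the product is that of distinct generators: each power contributes all
its `p - 1` pairs with coefficient `(p - 1)!`. -/
theorem prod_sym_grassmannNil_mul_ne_zero [HasCentralCommutators (InfGrassmann k)]
    [Invertible (2 : InfGrassmann k)] {p : ℕ} [Fact p.Prime] [CharP k p] (h2 : (2 : k) ≠ 0)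
    {J : Finset ℕ} (hJ : Even J.card) (s : Finset ℕ) :
    (∏ i ∈ s, sym (grassmannNil k p i) ^ (p - 1)) *
      sym (commProd (grassmannOdd k J) J.toList) ≠ 0 := by
  have hp := (Fact.out : p.Prime)
  have h1 : ∀ i, sym (grassmannNil k p i) ^ (p - 1) =
      algebraMap k _ ((p - 1).factorial : k) *
        ∏ j ∈ Finset.range (p - 1), sym (grassmannPair k (i, j)) := by
    intro i
    have hsum : sym (grassmannNil k p i) =
        ∑ j ∈ Finset.range (p - 1), sym (grassmannPair k (i, j)) :=
      map_sum (AddMonoidHom.mk' sym sym_add) _ _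
    have := sum_pow_card_of_mul_self_eq_zero (Finset.range (p - 1))
      (fun j => sym (grassmannPair k (i, j)))
      fun j => by rw [← sym_mul_self, grassmannPair_mul_self, sym_zero]
    rw [Finset.card_range] at this
    rw [hsum, this, map_natCast]
  have hfac : ((p - 1).factorial : k) ≠ 0 := by
    rw [Ne, CharP.cast_eq_zero_iff k p, hp.dvd_factorial]
    have := hp.pos
    omega
  have hprod : ∏ i ∈ s, ∏ j ∈ Finset.range (p - 1), sym (grassmannPair k (i, j)) =
      ((s ×ˢ Finset.range (p - 1)).toList.map fun t => sym (grassmannPair k t)).prod := by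
    rw [Finset.prod_map_toList, Finset.prod_product]
  simp only [h1]
  rw [Finset.prod_mul_distrib, Finset.prod_const, ← map_pow, hprod, mul_assoc,
    prod_sym_grassmannPair_mul_sym, commProd_grassmannOdd hJ, ← Algebra.smul_def,
    ← Algebra.smul_def, mul_smul_comm, ← prod_map_pairIndices, ← List.prod_append,
    ← List.map_append, sym_smul]
  refine smul_ne_zero (pow_ne_zero _ hfac) (smul_ne_zero (pow_ne_zero _ h2) ?_)
  intro h
  exact prod_map_grassmannGen_ne_zero
    (nodup_pairIndices_append (Finset.nodup_toList _) (Finset.nodup_toList _)) (sym_injective h)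

/-- Reduced normal forms that vanish under all substitutions from the Grassmann algebra are zero.
For an index set `J` that is minimal among those with nonzero coefficient, let exactly the
variables in `J` have odd parts; then only the summand for `J` survives. -/
theorem normalForm_eq_zero [Finite k] [HasCentralCommutators (InfGrassmann k)]
    [Invertible (2 : InfGrassmann k)] {p : ℕ} [Fact p.Prime] [CharP k p] (h2 : (2 : k) ≠ 0)
    (d : {J : Finset ℕ // Even J.card} →₀ reducedPolynomials ℕ k (Nat.card k * p))
    (h : ∀ y : ℕ → InfGrassmann k,
      (d.sum fun J f => aeval (fun i => sym (y i)) f.1 * sym (commProd y J.1.toList)) = 0) :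
    d = 0 := by
  by_contra hd
  obtain ⟨J, hJ⟩ := d.support.exists_minimal (Finsupp.support_nonempty_iff.2 hd)
  refine Finsupp.mem_support_iff.1 hJ.1 (Subtype.ext ?_)
  set w := sym (commProd (grassmannOdd k J.1) J.1.toList)
  refine eq_zero_of_aeval_add_nilpotent (mem_reducedPolynomials.1 (d J).2)
    (n := fun i => sym (grassmannNil k p i)) (w := w)
    (fun i => by rw [← SymAlg.sym_pow, grassmannNil_pow h2, sym_zero])
    (fun s => prod_sym_grassmannNil_mul_ne_zero h2 J.2 s) fun a => ?_
  let c : ℕ → InfGrassmann k := fun i => algebraMap k _ (a i) + grassmannNil k p i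
  have hc : ∀ i z, Commute (c i) z := fun i z =>
    Commute.add_left (Algebra.commutes (a i) z) (commute_grassmannNil p i z)
  have h1 := h fun i => c i + grassmannOdd k J.1 i
  simp only [commProd_add_of_commute hc] at h1
  rw [Finsupp.sum, Finset.sum_eq_single J] at h1
  · rw [← h1]
    refine (aeval_mul_eq_of_forall_mul_eq (fun i => ?_) _).symm
    rw [sym_add, add_mul, ← sym_algebraMap, ← sym_add, add_eq_left,
      ← sym_mul_of_commute (commute_commProd _ _ _).symm, grassmannOdd_mul_commProd J.2, sym_zero]
  · intro K hK hne
    have hKJ : ¬ K.1 ⊆ J.1 := fun hle => hne (le_antisymm hle (hJ.2 hK hle))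
    obtain ⟨i, hiK, hiJ⟩ := Finset.not_subset.1 hKJ
    rw [commProd_eq_zero_of_mem (x := grassmannOdd k J.1) (i := i) (if_neg hiJ) _
      (Finset.mem_toList.2 hiK), sym_zero, mul_zero]
  · exact fun hn => absurd hJ.1 hn

end Independence

/-! ### T-ideals and their quotients -/

section TIdeals

open SymAlg MvPolynomial

variable {k A : Type*} [Field k] [Ring A] [Algebra k A]

theorem isTIdeal_identitiesTIdeal (k A : Type*) [CommRing k] [Ring A] [Algebra k A] :
    IsTIdeal k (identitiesTIdeal k A) := fun ψ a ha => by
  rw [mem_identitiesTIdeal] at ha ⊢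
  exact fun φ => ha (φ.comp ψ)

/-- The quotient map by a two-sided ideal, as an algebra homomorphism. -/
def TwoSidedIdeal.mkAlgHom (k : Type*) {R : Type*} [CommRing k] [Ring R] [Algebra k R]
    (I : TwoSidedIdeal R) : R →ₐ[k] I.ringCon.Quotient :=
  I.ringCon.mkₐ k

theorem TwoSidedIdeal.mkAlgHom_surjective {R : Type*} [Ring R] [Algebra k R]
    (I : TwoSidedIdeal R) : Function.Surjective (I.mkAlgHom k) :=
  I.ringCon.mk'_surjective

theorem TwoSidedIdeal.mkAlgHom_eq_zero_iff {R : Type*} [Ring R] [Algebra k R]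
    {I : TwoSidedIdeal R} {r : R} : I.mkAlgHom k r = 0 ↔ r ∈ I := by
  rw [I.mem_iff]
  exact RingCon.eq _

theorem TwoSidedIdeal.exists_comp_mkAlgHom_eq {R : Type*} [Ring R] [Algebra k R]
    {I : TwoSidedIdeal R} (φ : R →ₐ[k] A) (hφ : ∀ r ∈ I, φ r = 0) :
    ∃ ψ : I.ringCon.Quotient →ₐ[k] A, ∀ r, ψ (I.mkAlgHom k r) = φ r := by
  have h : I.ringCon ≤ RingCon.ker (φ : R →+* A) := fun r s hrs => by
    change φ r = φ s
    rw [← sub_eq_zero, ← map_sub]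
    exact hφ _ ((I.rel_iff r s).1 hrs)
  exact ⟨I.ringCon.liftₐ φ h, fun r => rfl⟩

/-- In odd characteristic, an identity of the Grassmann algebra vanishes in every quotient of the
free algebra that has central commutators and in which `a ^ (|k| * p) = a ^ p`, provided that the
substitutions from the Grassmann algebra factor through the quotient. -/
theorem eq_zero_of_odd_of_forall_eq_zero [Finite k] {p : ℕ} [Fact p.Prime] [CharP k p]
    (h2 : (2 : k) ≠ 0) (π : FreeAlgebra k ℕ →ₐ[k] A) (hlie : ∀ a b c : A, ⁅⁅a, b⁆, c⁆ = 0)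
    (hpow : ∀ a : A, a ^ (Nat.card k * p) = a ^ p)
    (hlift : ∀ φ : FreeAlgebra k ℕ →ₐ[k] InfGrassmann k,
      ∃ ψ : A →ₐ[k] InfGrassmann k, ∀ f, ψ (π f) = φ f)
    {f : FreeAlgebra k ℕ} (hf : ∀ φ : FreeAlgebra k ℕ →ₐ[k] InfGrassmann k, φ f = 0) :
    π f = 0 := by
  have hp := (Fact.out : p.Prime)
  have : HasCentralCommutators A := ⟨hlie⟩
  have : HasCentralCommutators (InfGrassmann k) := ⟨ExteriorAlgebra.lie_lie_eq_zero h2⟩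
  let := invertibleTwoOfAlgebra (A := A) h2
  let := invertibleTwoOfAlgebra (A := InfGrassmann k) h2
  have hlt : p < Nat.card k * p := lt_mul_of_one_lt_left hp.pos Finite.one_lt_card
  obtain ⟨d, hd⟩ := exists_normalForm hlt hpow _ (sym_freeAlgebra_mem_normalSpan h2 π f)
  suffices hd0 : d = 0 by
    rw [hd0, Finsupp.sum_zero_index] at hd
    exact sym_injective hd
  refine normalForm_eq_zero h2 d fun y => ?_
  obtain ⟨ψ, hψ⟩ := hlift (FreeAlgebra.lift k y)
  have hy : ∀ i, ψ (π (FreeAlgebra.ι k i)) = y i := fun i => by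
    rw [hψ, FreeAlgebra.lift_ι_apply]
  have h1 := congrArg (mapAlgHom ψ) hd
  rw [mapAlgHom_sym, hψ, hf, sym_zero, Finsupp.sum, map_sum] at h1
  rw [Finsupp.sum, h1]
  refine Finset.sum_congr rfl fun J _ => ?_
  rw [map_mul, mapAlgHom_sym, map_commProd ψ, comp_aeval_apply]
  simp only [mapAlgHom_sym, hy]

/-- In characteristic two, an identity of the Grassmann algebra vanishes in every commutative
quotient of the free algebra in which `a ^ (2 * |k|) = a ^ 2`, provided that the substitutions
from the Grassmann algebra factor through the quotient. -/
theorem eq_zero_of_char_two_of_forall_eq_zero [Finite k] [CharP k 2]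
    (π : FreeAlgebra k ℕ →ₐ[k] A) (hcomm : ∀ a b : A, a * b = b * a)
    (hpow : ∀ a : A, a ^ (Nat.card k * 2) = a ^ 2)
    (hlift : ∀ φ : FreeAlgebra k ℕ →ₐ[k] InfGrassmann k,
      ∃ ψ : A →ₐ[k] InfGrassmann k, ∀ f, ψ (π f) = φ f)
    {f : FreeAlgebra k ℕ} (hf : ∀ φ : FreeAlgebra k ℕ →ₐ[k] InfGrassmann k, φ f = 0) :
    π f = 0 := by
  let : CommRing A := { (inferInstance : Ring A) with mul_comm := hcomm }
  let : CommRing (InfGrassmann k) :=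
    { (inferInstance : Ring (InfGrassmann k)) with
      mul_comm := ExteriorAlgebra.mul_comm_of_char_two }
  let x : ℕ → A := fun i => π (FreeAlgebra.ι k i)
  have hlt : 2 < Nat.card k * 2 := lt_mul_of_one_lt_left two_pos Finite.one_lt_card
  have hpoly : ∃ g : MvPolynomial ℕ k, aeval x g = π f := by
    let θ : FreeAlgebra k ℕ →ₐ[k] MvPolynomial ℕ k := FreeAlgebra.lift k X
    refine ⟨θ f, ?_⟩
    have : (aeval x).comp θ = π := by
      ext i
      simp [θ, x]
    rw [← this]
    rfl
  obtain ⟨g, hg⟩ := hpoly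
  obtain ⟨g, hgred, hg'⟩ := exists_reduced_aeval_eq hlt x hpow g
  rw [← hg, ← hg']
  suffices hg0 : g = 0 by rw [hg0, map_zero]
  refine eq_zero_of_aeval_add_nilpotent (mem_reducedPolynomials.1 hgred)
    (n := fun i => ExteriorAlgebra.ι k (Finsupp.single i (1 : k))) (w := 1)
    (fun i => by rw [pow_two, ExteriorAlgebra.ι_sq_zero]) (fun s => ?_) fun a => ?_
  · have := ExteriorAlgebra.prod_map_ι_single_ne_zero (k := k) s.nodup_toList
    simpa [Finset.prod_map_toList] using this
  · rw [mul_one]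
    obtain ⟨ψ, hψ⟩ := hlift (FreeAlgebra.lift k fun i => algebraMap k (InfGrassmann k) (a i) +
      ExteriorAlgebra.ι k (Finsupp.single i (1 : k)))
    have h1 := congrArg ψ (hg'.trans hg)
    rw [hψ, hf, comp_aeval_apply] at h1
    simpa [x, hψ] using h1

/-- The quotient of the free algebra by the T-ideal generated by `B` satisfies the identities
in `B`. -/
theorem mkAlgHom_tIdealSpan_apply_eq_zero {F : Type*} [Ring F] [Algebra k F] {B : Set F} {b : F}
    (hb : b ∈ B) (φ : F →ₐ[k] F) : (tIdealSpan k B).mkAlgHom k (φ b) = 0 := by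
  obtain ⟨⟨hT, hB⟩, -⟩ := isLeast_tIdealSpan k B
  exact TwoSidedIdeal.mkAlgHom_eq_zero_iff.2 (hT φ b (hB hb))

end TIdeals

theorem theorem3p1 (k : Type*) [Field k] [Finite k] (p q : ℕ) [CharP k p] (hq : Nat.card k = q)
    (x : ℕ → FreeAlgebra k ℕ) (hx : x = FreeAlgebra.ι k) :
    (p = 2 → identitiesTIdeal k (InfGrassmann k) =
      tIdealSpan k {x 1 ^ 2 - x 1 ^ (2 * q), ⁅x 1, x 2⁆}) ∧
    (2 < p → identitiesTIdeal k (InfGrassmann k) =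
      tIdealSpan k {x 1 ^ (q * p) - x 1 ^ p, ⁅⁅x 1, x 2⁆, x 3⁆}) := by
  have hp : Fact p.Prime := ⟨(CharP.char_is_prime_or_zero k p).resolve_right
    (CharP.char_ne_zero_of_finite k p)⟩
  subst hq hx
  refine ⟨fun hp2 => ?_, fun hp2 => ?_⟩
  · subst hp2
    set B : Set (FreeAlgebra k ℕ) := _
    change _ = tIdealSpan k B
    have hle : tIdealSpan k B ≤ identitiesTIdeal k (InfGrassmann k) := by
      refine (isLeast_tIdealSpan k B).2 ⟨isTIdeal_identitiesTIdeal k _, ?_⟩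
      rintro b (rfl | rfl) <;> refine mem_identitiesTIdeal.2 fun φ => ?_
      · rw [map_sub, map_pow, map_pow, mul_comm, ExteriorAlgebra.pow_card_mul_char, sub_self]
      · rw [Ring.lie_def, map_sub, map_mul, map_mul, ExteriorAlgebra.mul_comm_of_char_two, sub_self]
    refine le_antisymm (fun f hf => ?_) hle
    have hπ := (tIdealSpan k B).mkAlgHom_surjective (k := k)
    refine TwoSidedIdeal.mkAlgHom_eq_zero_iff.1
      (eq_zero_of_char_two_of_forall_eq_zero ((tIdealSpan k B).mkAlgHom k) ?_ ?_
        (fun φ => TwoSidedIdeal.exists_comp_mkAlgHom_eq φ fun r hr =>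
          mem_identitiesTIdeal.1 (hle hr) φ) (mem_identitiesTIdeal.1 hf))
    · intro a b
      obtain ⟨a, rfl⟩ := hπ a
      obtain ⟨b, rfl⟩ := hπ b
      have := mkAlgHom_tIdealSpan_apply_eq_zero (k := k) (B := B) (Or.inr rfl)
        (FreeAlgebra.lift k fun i => if i = 1 then a else b)
      simpa [Ring.lie_def, sub_eq_zero] using this
    · intro a
      obtain ⟨a, rfl⟩ := hπ a
      have := mkAlgHom_tIdealSpan_apply_eq_zero (k := k) (B := B) (Or.inl rfl)
        (FreeAlgebra.lift k fun _ => a)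
      refine (sub_eq_zero.1 ?_).symm
      simpa [mul_comm 2] using this
  · have h2 : (2 : k) ≠ 0 := fun h => by
      have := (CharP.cast_eq_zero_iff k p 2).1 (by exact_mod_cast h)
      exact absurd (Nat.le_of_dvd two_pos this) (by omega)
    set B : Set (FreeAlgebra k ℕ) := _
    change _ = tIdealSpan k B
    have hle : tIdealSpan k B ≤ identitiesTIdeal k (InfGrassmann k) := by
      refine (isLeast_tIdealSpan k B).2 ⟨isTIdeal_identitiesTIdeal k _, ?_⟩
      rintro b (rfl | rfl) <;> refine mem_identitiesTIdeal.2 fun φ => ?_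
      · rw [map_sub, map_pow, map_pow, ExteriorAlgebra.pow_card_mul_char, sub_self]
      · have := ExteriorAlgebra.lie_lie_eq_zero h2 (φ (FreeAlgebra.ι k 1)) (φ (FreeAlgebra.ι k 2))
          (φ (FreeAlgebra.ι k 3))
        simpa only [Ring.lie_def, map_sub, map_mul] using this
    refine le_antisymm (fun f hf => ?_) hle
    have hπ := (tIdealSpan k B).mkAlgHom_surjective (k := k)
    refine TwoSidedIdeal.mkAlgHom_eq_zero_iff.1
      (eq_zero_of_odd_of_forall_eq_zero (p := p) h2 ((tIdealSpan k B).mkAlgHom k) ?_ ?_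
        (fun φ => TwoSidedIdeal.exists_comp_mkAlgHom_eq φ fun r hr =>
          mem_identitiesTIdeal.1 (hle hr) φ) (mem_identitiesTIdeal.1 hf))
    · intro a b c
      obtain ⟨a, rfl⟩ := hπ a
      obtain ⟨b, rfl⟩ := hπ b
      obtain ⟨c, rfl⟩ := hπ c
      have := mkAlgHom_tIdealSpan_apply_eq_zero (k := k) (B := B) (Or.inr rfl)
        (FreeAlgebra.lift k fun i => if i = 1 then a else if i = 2 then b else c)
      simpa [Ring.lie_def] using this
    · intro a
      obtain ⟨a, rfl⟩ := hπ a
      have := mkAlgHom_tIdealSpan_apply_eq_zero (k := k) (B := B) (Or.inl rfl)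
        (FreeAlgebra.lift k fun _ => a)
      simpa [sub_eq_zero] using this
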